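/- Let $m\ge 0$, let $U\subset\mathbb{R}^m$ be open, and let $B_0\subset U$ be a compact neighborhood of a point $x_0$. Let $f:U\to\mathbb{C}$ be measurable such that (a) $f$ is real, positive and $C^4$ on $B_0$, $x_0$ is a critical point of $f$, and the $m\times m$ Hessian $f''(x_0)$ is negative-definite; (b) for every open set $V$ with $x_0\in V\subset B_0$, $\sup_{U\setminus V}|f|<f(x_0)$ (with $\sup\emptyset=0$). Let $(\phi_n)$ be a sequence of measurable real-valued functions on $U$ such that (c) $\phi_n(x_0)\ne 0$ for all $n$; (d) each $\phi_n$ is $C^1$ on $B_0$, and there is a constant $K_1$ with $\|\phi_n\|_{C^1}\le K_1|\phi_n(x_0)|$ for all sufficiently large $n$, where $\|\phi\|_{C^1}:=\sup_{B_0}|\phi|+\sup_{\operatorname{int}B_0}\|D\phi\|$; (e) there are $n_0\in\mathbb{N}$ and $K_2,k\in\mathbb{R}$ such that, for all sufficiently large $n$, $\phi_n f^{n_0}$ is integrable on $U\setminus B_0$ and $\int_{U\setminus B_0}|\phi_n(x)f(x)^{n_0}|\,dx<K_2\,n^k\,|\phi_n(x_0)|$. Then $\phi_n f^n$ is integrable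 on $U$ for all sufficiently large $n$, and $$\int_U\phi_n(x)f(x)^n\,dx\;\sim\;|\det f''(x_0)|^{-1/2}\left(\frac{2\pi}{n}\right)^{m/2}\phi_n(x_0)\,f(x_0)^{\,n+m/2}\qquad(n\to\infty).$$ Moreover, if $(\widehat\phi_n)$ is another sequence of measurable real-valued functions on $U$ satisfying (c), (d) and (e) (possibly with other constants), then $$\frac{\int_U\widehat\phi_n(x)f(x)^n\,dx}{\int_U\phi_n(x)f(x)^n\,dx}\;\sim\;\frac{\widehat\phi_n(x_0)}{\phi_n(x_0)}\qquad(n\to\infty).$$ Here $a_n\sim b_n$, for complex sequences with $b_n\ne 0$ for large $n$, means $a_n/b_n\to 1$. -/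

import Mathlib

open MeasureTheory Filter Topology Asymptotics
open scoped ENNReal

/-- The Hessian matrix `g''(x)` of a real-valued function on `ℝᵐ`: its `(i, j)` entry is the second
partial derivative `∂ᵢ ∂ⱼ g (x)`. -/
noncomputable def hessianMatrix {m : ℕ} (g : EuclideanSpace ℝ (Fin m) → ℝ)
    (x : EuclideanSpace ℝ (Fin m)) : Matrix (Fin m) (Fin m) ℝ :=
  Matrix.of fun i j =>
    fderiv ℝ (fun y => fderiv ℝ g y (EuclideanSpace.single j 1)) x (EuclideanSpace.single i 1)

/-- The `C¹`-norm on `B`: the supremum of `|g|` on `B` plus the supremum of the norm of its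
derivative, with values in `[0, ∞]`. The second supremum is taken over the interior of `B`, where
the derivative of a function on `B` is unambiguous. For a `C¹` function on a set `B` that is the
closure of its interior and has unique derivatives it is also the supremum over `B`. -/
noncomputable def c1Norm {m : ℕ} (B : Set (EuclideanSpace ℝ (Fin m)))
    (g : EuclideanSpace ℝ (Fin m) → ℝ) : ℝ≥0∞ :=
  (⨆ x ∈ B, ‖g x‖ₑ) + ⨆ x ∈ interior B, ‖fderiv ℝ g x‖ₑ

/-- The conditions on the exponentiated function `f : U → ℂ` (`f` is used only on `U`). -/
structure IsLaplaceBase {m : ℕ} (U B₀ : Set (EuclideanSpace ℝ (Fin m)))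
    (x₀ : EuclideanSpace ℝ (Fin m)) (f : EuclideanSpace ℝ (Fin m) → ℂ) : Prop where
  aestronglyMeasurable : AEStronglyMeasurable f (volume.restrict U)
  /-- `f` is real on `B₀`. -/
  real : ∀ x ∈ B₀, (f x).im = 0
  /-- `f` is positive on `B₀`. -/
  pos : ∀ x ∈ B₀, 0 < (f x).re
  contDiffOn : ContDiffOn ℝ 4 f B₀
  /-- `x₀` is a critical point of `f`. -/
  critical : fderiv ℝ f x₀ = 0
  /-- The Hessian of `f` at `x₀` is negative-definite. -/
  negDef : (-hessianMatrix (fun x => (f x).re) x₀).PosDef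
  /-- `|f|` is strictly dominated by `f(x₀)` away from `x₀`. -/
  dominated : ∀ V : Set (EuclideanSpace ℝ (Fin m)), IsOpen V → x₀ ∈ V → V ⊆ B₀ →
    (⨆ x ∈ U \ V, ‖f x‖ₑ) < ENNReal.ofReal (f x₀).re

/-- The conditions on the sequence `φ` of real-valued functions on `U`. -/
structure IsLaplaceAmplitude {m : ℕ} (U B₀ : Set (EuclideanSpace ℝ (Fin m)))
    (x₀ : EuclideanSpace ℝ (Fin m)) (f : EuclideanSpace ℝ (Fin m) → ℂ)
    (φ : ℕ → EuclideanSpace ℝ (Fin m) → ℝ) : Prop where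
  aestronglyMeasurable : ∀ n, AEStronglyMeasurable (φ n) (volume.restrict U)
  ne_zero : ∀ n, φ n x₀ ≠ 0
  contDiffOn : ∀ n, ContDiffOn ℝ 1 (φ n) B₀
  c1Norm_le : ∃ K₁ : ℝ, ∀ᶠ n in atTop, c1Norm B₀ (φ n) ≤ ENNReal.ofReal (K₁ * |φ n x₀|)
  tail : ∃ (n₀ : ℕ) (K₂ k : ℝ), ∀ᶠ n : ℕ in atTop,
    IntegrableOn (fun x => (φ n x : ℂ) * f x ^ n₀) (U \ B₀) ∧
    ∫ x in U \ B₀, ‖(φ n x : ℂ) * f x ^ n₀‖ < K₂ * (n : ℝ) ^ k * |φ n x₀|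

/-- Second-order Taylor expansion at a critical point. -/
theorem ContDiffAt.isLittleO_taylor_two {E : Type*} [NormedAddCommGroup E] [NormedSpace ℝ E]
    {g : E → ℝ} {x₀ : E} (hg : ContDiffAt ℝ 2 g x₀) (hcrit : fderiv ℝ g x₀ = 0) :
    (fun x => g x - g x₀ - (1 / 2) * fderiv ℝ (fderiv ℝ g) x₀ (x - x₀) (x - x₀))
      =o[𝓝 x₀] fun x => ‖x - x₀‖ ^ 2 := by
  set D := fderiv ℝ (fderiv ℝ g) x₀ with hD
  have hsymm : ∀ v w, D v w = D w v := hg.isSymmSndFDerivAt (by simp)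
  have hdiff : ∀ᶠ x in 𝓝 x₀, DifferentiableAt ℝ g x :=
    (hg.eventually (by simp)).mono fun x hx => hx.differentiableAt (by simp)
  obtain ⟨r, hr, hball⟩ := Metric.eventually_nhds_iff_ball.1 hdiff
  have hg' : HasFDerivAt (fderiv ℝ g) D x₀ :=
    ((hg.fderiv_right (m := 1) (by norm_num)).differentiableAt (by simp)).hasFDerivAt
  have hlo : (fun x => fderiv ℝ g x - D (x - x₀)) =o[𝓝 x₀] fun x => ‖x - x₀‖ ^ 1 := by
    have := hg'.isLittleO.norm_right
    simpa [hcrit] using this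
  have hder : ∀ x ∈ Metric.ball x₀ r,
      HasFDerivWithinAt (fun x => g x - (1 / 2) * D (x - x₀) (x - x₀))
        (fderiv ℝ g x - D (x - x₀)) (Metric.ball x₀ r) x := by
    intro x hx
    have h1 : HasFDerivAt (fun x => x - x₀) (ContinuousLinearMap.id ℝ E) x :=
      (hasFDerivAt_id x).sub_const x₀
    have h2 := D.hasFDerivAt_of_bilinear h1 h1
    have h3 := (hball x hx).hasFDerivAt.sub (h2.const_mul (1 / 2 : ℝ))
    refine HasFDerivAt.hasFDerivWithinAt (h3.congr_fderiv ?_)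
    ext v
    simp [hsymm v x, hsymm v x₀]
    ring
  have hs := (convex_ball x₀ r).isLittleO_pow_succ (Metric.mem_ball_self hr) hder
    (n := 1) (hlo.mono nhdsWithin_le_nhds)
  rw [nhdsWithin_eq_nhds.2 (Metric.ball_mem_nhds x₀ hr)] at hs
  refine hs.congr_left fun x => ?_
  simp
  ring

theorem fderiv_fderiv_apply_self_eq_dotProduct_hessianMatrix {m : ℕ}
    {g : EuclideanSpace ℝ (Fin m) → ℝ} {x₀ : EuclideanSpace ℝ (Fin m)}
    (hg : ContDiffAt ℝ 2 g x₀) (y : EuclideanSpace ℝ (Fin m)) :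
    fderiv ℝ (fderiv ℝ g) x₀ y y = y.ofLp ⬝ᵥ (hessianMatrix g x₀).mulVec y.ofLp := by
  have hd : DifferentiableAt ℝ (fderiv ℝ g) x₀ :=
    (hg.fderiv_right (m := 1) (by norm_num)).differentiableAt (by simp)
  have hH : ∀ i j, hessianMatrix g x₀ i j
      = fderiv ℝ (fderiv ℝ g) x₀ (EuclideanSpace.single i 1) (EuclideanSpace.single j 1) := by
    intro i j
    simp only [hessianMatrix, Matrix.of_apply]
    rw [fderiv_clm_apply hd (differentiableAt_const _)]
    simp
  have hy : y = ∑ i, y i • EuclideanSpace.single i (1 : ℝ) := by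
    ext j
    simp [Finset.sum_apply, Pi.single_apply]
  conv_lhs => rw [hy]
  simp only [map_sum, map_smul, _root_.sum_apply, _root_.smul_apply,
    smul_eq_mul, dotProduct, Matrix.mulVec, hH, Finset.mul_sum]
  rw [Finset.sum_comm]
  refine Finset.sum_congr rfl fun i _ => Finset.sum_congr rfl fun j _ => ?_
  ring

open Matrix MatrixOrder in
/-- The integral of a Gaussian function with positive-definite quadratic form. -/
theorem Matrix.PosDef.integral_exp_neg_half {ι : Type*} [Fintype ι] [DecidableEq ι]
    {A : Matrix ι ι ℝ} (hA : A.PosDef) :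
    ∫ y : EuclideanSpace ℝ ι, Real.exp (-((1 / 2) * (y.ofLp ⬝ᵥ A *ᵥ y.ofLp)))
      = (2 * Real.pi) ^ ((Fintype.card ι : ℝ) / 2) * A.det ^ (-(1 / 2) : ℝ) := by
  set S := CFC.sqrt A with hS
  have hAnn : 0 ≤ A := hA.posSemidef.nonneg
  have hSS : S * S = A := CFC.sqrt_mul_sqrt_self A hAnn
  have hSh : Sᵀ = S := by
    simpa using (CFC.sqrt_nonneg A).posSemidef.isHermitian.eq
  have hdet : S.det = Real.sqrt A.det := by
    rw [hS, hA.posSemidef.det_sqrt, RCLike.sqrt_of_nonneg hA.posSemidef.det_nonneg]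
    simp
  have hdpos : 0 < S.det := by rw [hdet]; exact Real.sqrt_pos.2 hA.det_pos
  let T : EuclideanSpace ℝ ι →L[ℝ] EuclideanSpace ℝ ι := toEuclideanCLM (n := ι) (𝕜 := ℝ) S
  have hTdet : T.det = S.det := LinearMap.det_toLpLin 2 S
  have hTu : IsUnit (LinearMap.det (T : EuclideanSpace ℝ ι →ₗ[ℝ] EuclideanSpace ℝ ι)) := by
    change IsUnit T.det
    rw [hTdet]; exact hdpos.ne'.isUnit
  have hTb : Function.Bijective T := by
    have := LinearEquiv.bijective (LinearEquiv.ofIsUnitDet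
      (f := (T : EuclideanSpace ℝ ι →ₗ[ℝ] EuclideanSpace ℝ ι))
      (v := (EuclideanSpace.basisFun ι ℝ).toBasis) (v' := (EuclideanSpace.basisFun ι ℝ).toBasis)
      (by rwa [LinearMap.det_toMatrix]))
    exact this
  have hnorm : ∀ y, ‖T y‖ ^ 2 = y.ofLp ⬝ᵥ A *ᵥ y.ofLp := by
    intro y
    rw [EuclideanSpace.real_norm_sq_eq, ← hSS, ← mulVec_mulVec, dotProduct_mulVec,
      ← mulVec_transpose, hSh]
    simp [T, dotProduct, sq]
  have hcv := integral_image_eq_integral_abs_det_fderiv_smul volume MeasurableSet.univ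
    (fun x _ => T.hasFDerivAt.hasFDerivWithinAt) hTb.1.injOn
    (fun y : EuclideanSpace ℝ ι => Real.exp (-(1 / 2) * ‖y‖ ^ 2))
  rw [Set.image_univ, hTb.2.range_eq, setIntegral_univ, setIntegral_univ,
    GaussianFourier.integral_rexp_neg_mul_sq_norm (by norm_num)] at hcv
  simp only [smul_eq_mul, integral_const_mul, hTdet, abs_of_pos hdpos, hnorm,
    finrank_euclideanSpace] at hcv
  simp only [neg_mul] at hcv
  have hinv : A.det ^ (-(1 / 2) : ℝ) = S.det⁻¹ := by
    rw [hdet, Real.sqrt_eq_rpow, Real.rpow_neg hA.det_pos.le]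
  rw [hinv, show 2 * Real.pi = Real.pi / (1 / 2) by ring, hcv]
  field_simp

theorem exists_forall_le_exp_neg_mul_norm_sq {E : Type*} [NormedAddCommGroup E]
    {B : Set E} (hB : Bornology.IsBounded B) {x₀ : E} {g q : E → ℝ}
    (hT : (fun x => g x - 1 + q (x - x₀)) =o[𝓝 x₀] fun x => ‖x - x₀‖ ^ 2)
    {c : ℝ} (hc : 0 < c) (hq : ∀ y, c * ‖y‖ ^ 2 ≤ q y)
    (hdom : ∀ δ > 0, ∃ r < 1, ∀ x ∈ B, δ ≤ ‖x - x₀‖ → g x ≤ r) :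
    ∃ c' > 0, ∀ x ∈ B, g x ≤ Real.exp (-(c' * ‖x - x₀‖ ^ 2)) := by
  obtain ⟨δ, hδ, hnear⟩ := Metric.eventually_nhds_iff_ball.1 (hT.def (half_pos hc))
  obtain ⟨r, hr, hfar⟩ := hdom δ hδ
  obtain ⟨R, hR⟩ := hB.subset_closedBall x₀
  set r' := max r (1 / 2) with hr'
  have hr'1 : r' < 1 := max_lt hr (by norm_num)
  have hr'0 : 0 < r' := lt_max_of_lt_right (by norm_num)
  have hlog : 0 < -Real.log r' := neg_pos.2 (Real.log_neg hr'0 hr'1)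
  refine ⟨min (c / 2) (-Real.log r' / (R ^ 2 + 1)), by positivity, fun x hx => ?_⟩
  rcases lt_or_ge ‖x - x₀‖ δ with hxδ | hxδ
  · have h1 := (abs_le.1 (hnear x (by simpa [dist_eq_norm] using hxδ))).2
    rw [norm_pow, norm_norm] at h1
    have h2 := hq (x - x₀)
    have h3 : min (c / 2) (-Real.log r' / (R ^ 2 + 1)) * ‖x - x₀‖ ^ 2 ≤ c / 2 * ‖x - x₀‖ ^ 2 := by
      gcongr; exact min_le_left _ _
    have h4 := Real.add_one_le_exp (-(min (c / 2) (-Real.log r' / (R ^ 2 + 1)) * ‖x - x₀‖ ^ 2))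
    linarith
  · have hxR : ‖x - x₀‖ ≤ R := by simpa [dist_eq_norm] using hR hx
    calc g x ≤ r' := (hfar x hx hxδ).trans (le_max_left _ _)
      _ = Real.exp (Real.log r') := (Real.exp_log hr'0).symm
      _ ≤ _ := by
        rw [Real.exp_le_exp, le_neg]
        calc min (c / 2) (-Real.log r' / (R ^ 2 + 1)) * ‖x - x₀‖ ^ 2
            ≤ -Real.log r' / (R ^ 2 + 1) * (R ^ 2 + 1) := by
              gcongr
              · exact min_le_right _ _
              · have : ‖x - x₀‖ ^ 2 ≤ R ^ 2 := by gcongr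
                linarith
          _ = -Real.log r' := div_mul_cancel₀ _ (by positivity)

theorem integrable_exp_neg_mul_norm_sq (E : Type*) [NormedAddCommGroup E] [InnerProductSpace ℝ E]
    [FiniteDimensional ℝ E] [MeasurableSpace E] [BorelSpace E] {c : ℝ} (hc : 0 < c) :
    Integrable fun y : E => Real.exp (-(c * ‖y‖ ^ 2)) := by
  by_contra h
  have h1 := GaussianFourier.integral_rexp_neg_mul_sq_norm (V := E) hc
  simp only [neg_mul] at h1
  rw [integral_undef h] at h1
  have : 0 < (Real.pi / c) ^ (Module.finrank ℝ E / 2 : ℝ) := by positivity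
  exact this.ne h1

theorem tendsto_pow_exp_neg_of_isLittleO {E : Type*} [NormedAddCommGroup E] [NormedSpace ℝ E]
    {x₀ : E} {g q : E → ℝ} (hq : ∀ (t : ℝ) y, q (t • y) = t ^ 2 * q y)
    (hT : (fun x => g x - 1 + q (x - x₀)) =o[𝓝 x₀] fun x => ‖x - x₀‖ ^ 2) (y : E)
    (hy : Tendsto (fun n : ℕ => x₀ + (√(n : ℝ))⁻¹ • y) atTop (𝓝 x₀)) :
    Tendsto (fun n : ℕ => g (x₀ + (√(n : ℝ))⁻¹ • y) ^ n) atTop (𝓝 (Real.exp (-q y))) := by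
  have h1 := hT.comp_tendsto hy
  have h2 : Tendsto (fun n : ℕ => (n : ℝ) * (g (x₀ + (√(n : ℝ))⁻¹ • y) - 1)) atTop
      (𝓝 (-q y)) := by
    have h3 : (fun n : ℕ => (n : ℝ) * (g (x₀ + (√(n : ℝ))⁻¹ • y) - 1) + q y)
        =o[atTop] fun _ => ‖y‖ ^ 2 := by
      have h4 := (isBigO_refl (fun n : ℕ => (n : ℝ)) atTop).mul_isLittleO h1
      refine h4.congr' ?_ ?_ <;> filter_upwards [eventually_gt_atTop 0] with n hn
      · have hn' : (0 : ℝ) < n := by exact_mod_cast hn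
        simp only [Function.comp_apply, add_sub_cancel_left, hq, inv_pow, Real.sq_sqrt hn'.le]
        field_simp
      · have hn' : (0 : ℝ) < n := by exact_mod_cast hn
        simp only [Function.comp_apply, add_sub_cancel_left, norm_smul, mul_pow, norm_inv,
          Real.norm_eq_abs, sq_abs, inv_pow, Real.sq_sqrt hn'.le]
        field_simp
    have h5 : Tendsto (fun n : ℕ => (n : ℝ) * (g (x₀ + (√(n : ℝ))⁻¹ • y) - 1) + q y) atTop
        (𝓝 0) := (isLittleO_one_iff ℝ).1 (h3.trans_isBigO (isBigO_const_const _ one_ne_zero _))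
    simpa using h5.sub_const (q y)
  simpa using Real.tendsto_one_add_pow_exp_of_tendsto h2

/-- Laplace's method for a normalized nonnegative function with Gaussian upper bound. -/
theorem tendsto_sqrt_pow_mul_setIntegral {E : Type*} [NormedAddCommGroup E]
    [InnerProductSpace ℝ E] [FiniteDimensional ℝ E] [MeasurableSpace E] [BorelSpace E]
    {B : Set E} (hB : MeasurableSet B) {x₀ : E} (hx₀ : B ∈ 𝓝 x₀) {g q : E → ℝ}
    (hg : ContinuousOn g B) (hg0 : ∀ x ∈ B, 0 ≤ g x) {c : ℝ} (hc : 0 < c)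
    (hgc : ∀ x ∈ B, g x ≤ Real.exp (-(c * ‖x - x₀‖ ^ 2)))
    (hq : ∀ (t : ℝ) y, q (t • y) = t ^ 2 * q y)
    (hT : (fun x => g x - 1 + q (x - x₀)) =o[𝓝 x₀] fun x => ‖x - x₀‖ ^ 2)
    {h : ℕ → E → ℝ} (hh : ∀ n, ContinuousOn (h n) B) {K : ℝ}
    (hK : ∀ᶠ n in atTop, ∀ x ∈ B, |h n x| ≤ K)
    (hlim : ∀ u : ℕ → E, Tendsto u atTop (𝓝 x₀) → Tendsto (fun n => h n (u n)) atTop (𝓝 1)) :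
    Tendsto (fun n : ℕ => √(n : ℝ) ^ Module.finrank ℝ E * ∫ x in B, h n x * g x ^ n) atTop
      (𝓝 (∫ y, Real.exp (-q y))) := by
  set F : ℕ → E → ℝ := fun n => B.indicator fun x => h n x * g x ^ n with hF
  have hresc : ∀ n : ℕ, √(n : ℝ) ^ Module.finrank ℝ E * ∫ x in B, h n x * g x ^ n
      = ∫ y, F n (x₀ + (√(n : ℝ))⁻¹ • y) := by
    intro n
    rw [Measure.integral_comp_inv_smul_of_nonneg volume (fun z => F n (x₀ + z))
      (Real.sqrt_nonneg _), integral_add_left_eq_self (F n), integral_indicator hB, smul_eq_mul]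
  have hto : ∀ y : E, Tendsto (fun n : ℕ => x₀ + (√(n : ℝ))⁻¹ • y) atTop (𝓝 x₀) := by
    intro y
    have h1 : Tendsto (fun n : ℕ => (√(n : ℝ))⁻¹) atTop (𝓝 0) :=
      (Real.tendsto_sqrt_atTop.comp tendsto_natCast_atTop_atTop).inv_tendsto_atTop
    simpa using (h1.smul_const y).const_add x₀
  simp only [hresc]
  refine tendsto_integral_filter_of_dominated_convergence
    (fun y => K * Real.exp (-(c * ‖y‖ ^ 2))) ?_ ?_
    ((integrable_exp_neg_mul_norm_sq E hc).const_mul K) ?_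
  · refine Eventually.of_forall fun n => ?_
    have hFm : Measurable (F n) := by
      classical
      rw [hF]
      simp only
      rw [← Set.piecewise_eq_indicator]
      exact ((hh n).mul (hg.pow n)).measurable_piecewise continuousOn_const hB
    exact (hFm.comp (by fun_prop)).aestronglyMeasurable
  · filter_upwards [hK, eventually_gt_atTop 0] with n hn hn0
    refine Eventually.of_forall fun y => ?_
    have hK0 : 0 ≤ K := (abs_nonneg _).trans (hn x₀ (mem_of_mem_nhds hx₀))
    by_cases hy : x₀ + (√(n : ℝ))⁻¹ • y ∈ B
    · simp only [hF, Set.indicator_of_mem hy, norm_mul, norm_pow, Real.norm_eq_abs,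
        abs_of_nonneg (hg0 _ hy)]
      refine mul_le_mul (hn _ hy) ?_ (pow_nonneg (hg0 _ hy) _) hK0
      refine (pow_le_pow_left₀ (hg0 _ hy) (hgc _ hy) n).trans_eq ?_
      rw [← Real.exp_nat_mul]
      have hn' : (0 : ℝ) < n := by exact_mod_cast hn0
      simp only [add_sub_cancel_left, norm_smul, mul_pow, norm_inv,
        Real.norm_eq_abs, sq_abs, inv_pow, Real.sq_sqrt hn'.le]
      congr 1
      field_simp
    · simp only [hF, Set.indicator_of_notMem hy, norm_zero]
      positivity
  · refine Eventually.of_forall fun y => ?_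
    have h1 := (hlim _ (hto y)).mul (tendsto_pow_exp_neg_of_isLittleO hq hT y (hto y))
    rw [one_mul] at h1
    refine h1.congr' ?_
    filter_upwards [(hto y).eventually hx₀] with n hn
    simp only [hF]
    rw [Set.indicator_of_mem hn]

theorem IsLaplaceBase.exists_norm_le {m : ℕ} {U B₀ : Set (EuclideanSpace ℝ (Fin m))}
    {x₀ : EuclideanSpace ℝ (Fin m)} {f : EuclideanSpace ℝ (Fin m) → ℂ}
    (hf : IsLaplaceBase U B₀ x₀ f) (hx₀ : B₀ ∈ 𝓝 x₀) {V : Set (EuclideanSpace ℝ (Fin m))}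
    (hV : IsOpen V) (hxV : x₀ ∈ V) (hVB : V ⊆ B₀) :
    ∃ c, 0 < c ∧ c < (f x₀).re ∧ ∀ x ∈ U \ V, ‖f x‖ ≤ c := by
  have hpos := hf.pos x₀ (mem_of_mem_nhds hx₀)
  have hlt := hf.dominated V hV hxV hVB
  set s := ⨆ x ∈ U \ V, ‖f x‖ₑ with hs
  have hsfin : s ≠ ⊤ := (hlt.trans ENNReal.ofReal_lt_top).ne
  have hsr : s.toReal < (f x₀).re := by
    rwa [← ENNReal.lt_ofReal_iff_toReal_lt hsfin]
  refine ⟨max s.toReal ((f x₀).re / 2), lt_max_of_lt_right (half_pos hpos),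
    max_lt hsr (half_lt_self hpos), fun x hx => le_max_of_le_left ?_⟩
  have h1 : ‖f x‖ₑ ≤ s := le_iSup₂ (f := fun x (_ : x ∈ U \ V) => ‖f x‖ₑ) x hx
  simpa using ENNReal.toReal_mono hsfin h1

theorem IsLaplaceBase.contDiffAt_re {m : ℕ} {U B₀ : Set (EuclideanSpace ℝ (Fin m))}
    {x₀ : EuclideanSpace ℝ (Fin m)} {f : EuclideanSpace ℝ (Fin m) → ℂ}
    (hf : IsLaplaceBase U B₀ x₀ f) (hx₀ : B₀ ∈ 𝓝 x₀) :
    ContDiffAt ℝ 2 (fun x => (f x).re) x₀ :=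
  Complex.reCLM.contDiff.contDiffAt.comp x₀
    ((hf.contDiffOn.contDiffAt hx₀).of_le (by norm_num))

theorem IsLaplaceBase.fderiv_re_eq_zero {m : ℕ} {U B₀ : Set (EuclideanSpace ℝ (Fin m))}
    {x₀ : EuclideanSpace ℝ (Fin m)} {f : EuclideanSpace ℝ (Fin m) → ℂ}
    (hf : IsLaplaceBase U B₀ x₀ f) (hx₀ : B₀ ∈ 𝓝 x₀) :
    fderiv ℝ (fun x => (f x).re) x₀ = 0 := by
  have hd : DifferentiableAt ℝ f x₀ :=
    (hf.contDiffOn.contDiffAt hx₀).differentiableAt (by norm_num)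
  have h := (Complex.reCLM.hasFDerivAt.comp x₀ hd.hasFDerivAt).fderiv
  rw [hf.critical, ContinuousLinearMap.comp_zero] at h
  exact h

theorem Matrix.PosDef.exists_mul_norm_sq_le {ι : Type*} [Fintype ι] {A : Matrix ι ι ℝ}
    (hA : A.PosDef) :
    ∃ c > 0, ∀ y : EuclideanSpace ℝ ι, c * ‖y‖ ^ 2 ≤ y.ofLp ⬝ᵥ A.mulVec y.ofLp := by
  have hcont : Continuous fun y : EuclideanSpace ℝ ι => y.ofLp ⬝ᵥ A.mulVec y.ofLp := by
    unfold dotProduct Matrix.mulVec dotProduct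
    fun_prop
  rcases (Metric.sphere (0 : EuclideanSpace ℝ ι) 1).eq_empty_or_nonempty with he | hne
  · refine ⟨1, one_pos, fun y => ?_⟩
    have hy : y = 0 := by
      by_contra hy
      have : ‖y‖⁻¹ • y ∈ Metric.sphere (0 : EuclideanSpace ℝ ι) 1 := by
        simp [norm_smul, hy]
      simp [he] at this
    simp [hy]
  · obtain ⟨z, hz, hmin⟩ :=
      (isCompact_sphere (0 : EuclideanSpace ℝ ι) 1).exists_isMinOn hne hcont.continuousOn
    have hz0 : z.ofLp ≠ 0 := by
      intro h0
      have : z = 0 := by ext i; simp [h0]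
      simp [this] at hz
    refine ⟨_, by simpa using hA.dotProduct_mulVec_pos hz0, fun y => ?_⟩
    rcases eq_or_ne y 0 with rfl | hy
    · simp
    have hn : 0 < ‖y‖ := norm_pos_iff.2 hy
    have hmem : ‖y‖⁻¹ • y ∈ Metric.sphere (0 : EuclideanSpace ℝ ι) 1 := by
      simp [norm_smul, hy]
    have h1 := hmin hmem
    simp only [Set.mem_ofPred_eq, WithLp.ofLp_smul, Matrix.mulVec_smul, dotProduct_smul,
      smul_dotProduct, smul_eq_mul] at h1
    have h2 := mul_le_mul_of_nonneg_right h1 (sq_nonneg ‖y‖)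
    refine h2.trans_eq ?_
    field_simp

theorem norm_le_of_c1Norm_le_ofReal {m : ℕ} {B : Set (EuclideanSpace ℝ (Fin m))}
    {g : EuclideanSpace ℝ (Fin m) → ℝ} {a : ℝ} (ha : 0 ≤ a)
    (h : c1Norm B g ≤ ENNReal.ofReal a) :
    (∀ x ∈ B, |g x| ≤ a) ∧ ∀ x ∈ interior B, ‖fderiv ℝ g x‖ ≤ a := by
  constructor
  · intro x hx
    have h1 : ‖g x‖ₑ ≤ ENNReal.ofReal a :=
      (le_iSup₂ (f := fun x (_ : x ∈ B) => ‖g x‖ₑ) x hx).trans (le_self_add.trans h)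
    rw [← ofReal_norm, ENNReal.ofReal_le_ofReal_iff ha] at h1
    exact h1
  · intro x hx
    have h1 : ‖fderiv ℝ g x‖ₑ ≤ ENNReal.ofReal a :=
      (le_iSup₂ (f := fun x (_ : x ∈ interior B) => ‖fderiv ℝ g x‖ₑ) x hx).trans
        (le_add_self.trans h)
    rwa [← ofReal_norm, ENNReal.ofReal_le_ofReal_iff ha] at h1

theorem IsLaplaceAmplitude.exists_eventually_bounds {m : ℕ}
    {U B₀ : Set (EuclideanSpace ℝ (Fin m))}
    {x₀ : EuclideanSpace ℝ (Fin m)} {f : EuclideanSpace ℝ (Fin m) → ℂ}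
    {φ : ℕ → EuclideanSpace ℝ (Fin m) → ℝ} (hφ : IsLaplaceAmplitude U B₀ x₀ f φ)
    (hx₀ : B₀ ∈ 𝓝 x₀) :
    ∃ K : ℝ, (∀ᶠ n in atTop, ∀ x ∈ B₀, |φ n x / φ n x₀| ≤ K) ∧
      ∃ δ > 0, ∀ᶠ n in atTop, ∀ x ∈ Metric.ball x₀ δ,
        |φ n x / φ n x₀ - 1| ≤ K * ‖x - x₀‖ := by
  obtain ⟨K₁, hK₁⟩ := hφ.c1Norm_le
  obtain ⟨δ, hδ, hball⟩ := Metric.isOpen_iff.1 isOpen_interior x₀ (mem_interior_iff_mem_nhds.2 hx₀)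
  have hbd : ∀ᶠ n in atTop, (∀ x ∈ B₀, |φ n x| ≤ |K₁| * |φ n x₀|) ∧
      ∀ x ∈ interior B₀, ‖fderiv ℝ (φ n) x‖ ≤ |K₁| * |φ n x₀| := by
    filter_upwards [hK₁] with n hn
    refine norm_le_of_c1Norm_le_ofReal (by positivity) (hn.trans (ENNReal.ofReal_le_ofReal ?_))
    gcongr
    exact le_abs_self _
  refine ⟨|K₁|, ?_, δ, hδ, ?_⟩
  · filter_upwards [hbd] with n hn x hx
    rw [abs_div, div_le_iff₀ (abs_pos.2 (hφ.ne_zero n))]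
    exact hn.1 x hx
  · filter_upwards [hbd] with n hn x hx
    have h1 := (convex_ball x₀ δ).norm_image_sub_le_of_norm_fderiv_le (𝕜 := ℝ) (f := φ n)
      (fun y hy => ((hφ.contDiffOn n).contDiffAt
        (mem_interior_iff_mem_nhds.1 (hball hy))).differentiableAt (by simp))
      (fun y hy => hn.2 y (hball hy)) (Metric.mem_ball_self hδ) hx
    rw [div_sub_one (hφ.ne_zero n), abs_div, div_le_iff₀ (abs_pos.2 (hφ.ne_zero n))]
    rw [Real.norm_eq_abs] at h1
    linarith

theorem IsLaplaceAmplitude.eventually_tail {m : ℕ} {U B₀ : Set (EuclideanSpace ℝ (Fin m))}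
    {x₀ : EuclideanSpace ℝ (Fin m)} {f : EuclideanSpace ℝ (Fin m) → ℂ}
    {φ : ℕ → EuclideanSpace ℝ (Fin m) → ℝ} (hφ : IsLaplaceAmplitude U B₀ x₀ f φ)
    (hfm : AEStronglyMeasurable f (volume.restrict U)) (hU : MeasurableSet U)
    (hB₀ : MeasurableSet B₀) {c : ℝ} (hc : 0 < c) (hfc : ∀ x ∈ U \ B₀, ‖f x‖ ≤ c) :
    ∃ C k : ℝ, ∀ᶠ n : ℕ in atTop,
      IntegrableOn (fun x => (φ n x : ℂ) * f x ^ n) (U \ B₀) ∧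
      ‖∫ x in U \ B₀, (φ n x : ℂ) * f x ^ n‖ ≤ C * (n : ℝ) ^ k * c ^ n * |φ n x₀| := by
  obtain ⟨n₀, K₂, k, hn₀⟩ := hφ.tail
  refine ⟨K₂ / c ^ n₀, k, ?_⟩
  filter_upwards [hn₀, eventually_ge_atTop n₀] with n ⟨hint, hlt⟩ hn
  have hpt : ∀ x ∈ U \ B₀, ‖(φ n x : ℂ) * f x ^ n‖
      ≤ c ^ (n - n₀) * ‖(φ n x : ℂ) * f x ^ n₀‖ := by
    intro x hx
    rw [← pow_sub_mul_pow (f x) hn, norm_mul, norm_mul, norm_mul, norm_pow (f x) (n - n₀)]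
    have := pow_le_pow_left₀ (norm_nonneg _) (hfc x hx) (n - n₀)
    calc _ = ‖f x‖ ^ (n - n₀) * (‖(φ n x : ℂ)‖ * ‖f x ^ n₀‖) := by ring
      _ ≤ _ := by gcongr
  have hae : ∀ᵐ x ∂(volume.restrict (U \ B₀)), ‖(φ n x : ℂ) * f x ^ n‖
      ≤ c ^ (n - n₀) * ‖(φ n x : ℂ) * f x ^ n₀‖ :=
    (ae_restrict_iff' (hU.diff hB₀)).2 (Eventually.of_forall hpt)
  have hdom := hint.norm.const_mul (c ^ (n - n₀))
  refine ⟨hdom.mono' ?_ hae, ?_⟩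
  · exact ((Complex.continuous_ofReal.comp_aestronglyMeasurable
      (hφ.aestronglyMeasurable n)).mul (hfm.pow n)).mono_measure
      (Measure.restrict_mono Set.sdiff_subset le_rfl)
  · calc _ ≤ ∫ x in U \ B₀, c ^ (n - n₀) * ‖(φ n x : ℂ) * f x ^ n₀‖ :=
        norm_integral_le_of_norm_le hdom hae
      _ = c ^ (n - n₀) * ∫ x in U \ B₀, ‖(φ n x : ℂ) * f x ^ n₀‖ := integral_const_mul _ _
      _ ≤ c ^ (n - n₀) * (K₂ * (n : ℝ) ^ k * |φ n x₀|) := by gcongr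
      _ = _ := by rw [pow_sub₀ _ hc.ne' hn]; ring

theorem tendsto_sqrt_pow_mul_rpow_mul_pow (d : ℕ) (k : ℝ) {r : ℝ} (hr0 : 0 < r) (hr1 : r < 1) :
    Tendsto (fun n : ℕ => √(n : ℝ) ^ d * (n : ℝ) ^ k * r ^ n) atTop (𝓝 0) := by
  have h := (tendsto_rpow_mul_exp_neg_mul_atTop_nhds_zero ((d : ℝ) / 2 + k) (-Real.log r)
    (neg_pos.2 (Real.log_neg hr0 hr1))).comp tendsto_natCast_atTop_atTop
  refine h.congr' ?_
  filter_upwards [eventually_gt_atTop 0] with n hn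
  have hn' : (0 : ℝ) < n := by exact_mod_cast hn
  have h1 : √(n : ℝ) ^ d = (n : ℝ) ^ ((d : ℝ) / 2) := by
    rw [Real.sqrt_eq_rpow, ← Real.rpow_natCast, ← Real.rpow_mul hn'.le]
    ring_nf
  have h2 : r ^ n = Real.exp (- -Real.log r * n) := by
    rw [neg_neg, mul_comm, Real.exp_nat_mul, Real.exp_log hr0]
  simp only [Function.comp_apply]
  rw [h1, h2, Real.rpow_add hn']

theorem IsLaplaceBase.tendsto_setIntegral {m : ℕ} {U B₀ : Set (EuclideanSpace ℝ (Fin m))}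
    {x₀ : EuclideanSpace ℝ (Fin m)} {f : EuclideanSpace ℝ (Fin m) → ℂ}
    (hf : IsLaplaceBase U B₀ x₀ f) (hB₀ : IsCompact B₀) (hx₀ : B₀ ∈ 𝓝 x₀) (hB₀U : B₀ ⊆ U)
    {φ : ℕ → EuclideanSpace ℝ (Fin m) → ℝ} (hφ : IsLaplaceAmplitude U B₀ x₀ f φ) :
    Tendsto (fun n : ℕ => √(n : ℝ) ^ m *
        ∫ x in B₀, φ n x / φ n x₀ * ((f x₀).re⁻¹ * (f x).re) ^ n) atTop
      (𝓝 ((2 * Real.pi * (f x₀).re) ^ ((m : ℝ) / 2)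
        * |(hessianMatrix (fun x => (f x).re) x₀).det| ^ (-(1 / 2) : ℝ))) := by
  have hmem := mem_of_mem_nhds hx₀
  have hpos := hf.pos x₀ hmem
  set H := hessianMatrix (fun x => (f x).re) x₀ with hH
  set A := (f x₀).re⁻¹ • (-H) with hA
  have hAp : A.PosDef := hf.negDef.smul (inv_pos.2 hpos)
  obtain ⟨c, hc, hcA⟩ := hAp.exists_mul_norm_sq_le
  set q : EuclideanSpace ℝ (Fin m) → ℝ := fun y => (1 / 2) * (y.ofLp ⬝ᵥ A.mulVec y.ofLp) with hq
  have hT : (fun x => (f x₀).re⁻¹ * (f x).re - 1 + q (x - x₀))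
      =o[𝓝 x₀] fun x => ‖x - x₀‖ ^ 2 := by
    have h1 := ((hf.contDiffAt_re hx₀).isLittleO_taylor_two
      (hf.fderiv_re_eq_zero hx₀)).const_mul_left (f x₀).re⁻¹
    refine h1.congr_left fun x => ?_
    rw [fderiv_fderiv_apply_self_eq_dotProduct_hessianMatrix (hf.contDiffAt_re hx₀)]
    simp only [hq, hA, Matrix.smul_mulVec, Matrix.neg_mulVec, dotProduct_smul, dotProduct_neg,
      smul_eq_mul]
    field_simp
    ring
  have hqs : ∀ (t : ℝ) y, q (t • y) = t ^ 2 * q y := by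
    intro t y
    simp only [hq, WithLp.ofLp_smul, Matrix.mulVec_smul, dotProduct_smul, smul_dotProduct,
      smul_eq_mul]
    ring
  have hdom : ∀ δ > 0, ∃ r < 1, ∀ x ∈ B₀, δ ≤ ‖x - x₀‖ → (f x₀).re⁻¹ * (f x).re ≤ r := by
    intro δ hδ
    obtain ⟨b, hb0, hb1, hb⟩ := hf.exists_norm_le hx₀
      (V := Metric.ball x₀ δ ∩ interior B₀) (Metric.isOpen_ball.inter isOpen_interior)
      ⟨Metric.mem_ball_self hδ, mem_interior_iff_mem_nhds.2 hx₀⟩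
      (Set.inter_subset_right.trans interior_subset)
    refine ⟨(f x₀).re⁻¹ * b, ?_, fun x hx hxδ => ?_⟩
    · rw [inv_mul_lt_iff₀ hpos]; simpa using hb1
    · have hxV : x ∈ U \ (Metric.ball x₀ δ ∩ interior B₀) := by
        refine ⟨hB₀U hx, fun h => ?_⟩
        have := h.1
        rw [Metric.mem_ball, dist_eq_norm] at this
        exact this.not_ge hxδ
      have := (Complex.re_le_norm _).trans (hb x hxV)
      gcongr
  obtain ⟨c', hc', hexp⟩ := exists_forall_le_exp_neg_mul_norm_sq hB₀.isBounded hT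
    (half_pos hc) (fun y => by have := hcA y; simp only [hq]; linarith) hdom
  obtain ⟨K, hK, δ, hδ, hLip⟩ := hφ.exists_eventually_bounds hx₀
  have hg : ContinuousOn (fun x => (f x₀).re⁻¹ * (f x).re) B₀ :=
    continuousOn_const.mul (Complex.continuous_re.comp_continuousOn hf.contDiffOn.continuousOn)
  have hmain := tendsto_sqrt_pow_mul_setIntegral hB₀.measurableSet hx₀ hg
    (fun x hx => (mul_pos (inv_pos.2 hpos) (hf.pos x hx)).le) hc' hexp hqs hT
    (h := fun n x => φ n x / φ n x₀)
    (fun n => (hφ.contDiffOn n).continuousOn.div_const _) hK ?_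
  · have hG := hAp.integral_exp_neg_half
    rw [finrank_euclideanSpace, Fintype.card_fin] at hmain
    rw [Fintype.card_fin] at hG
    convert hmain using 2
    simp only [hq]
    rw [hG]
    have hd : A.det = ((f x₀).re ^ m)⁻¹ * |H.det| := by
      have h0 := hf.negDef.det_pos
      rw [← hH] at h0
      have h1 : |H.det| = (-H).det := by
        rw [← abs_of_pos h0, Matrix.det_neg, abs_mul]
        simp
      rw [h1, hA, Matrix.det_smul, Fintype.card_fin, inv_pow]
    rw [hd, Real.mul_rpow (by positivity) hpos.le, Real.mul_rpow (by positivity) (abs_nonneg _),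
      Real.inv_rpow (by positivity), Real.rpow_neg (pow_nonneg hpos.le m) (1 / 2), inv_inv,
      ← Real.rpow_natCast, ← Real.rpow_mul hpos.le, mul_one_div]
    ring
  · intro u hu
    have h0 : Tendsto (fun n => K * ‖u n - x₀‖) atTop (𝓝 0) := by
      have := (tendsto_iff_norm_sub_tendsto_zero.1 hu).const_mul K
      simpa using this
    rw [tendsto_iff_norm_sub_tendsto_zero]
    refine squeeze_zero' (Eventually.of_forall fun _ => norm_nonneg _) ?_ h0
    filter_upwards [hLip, hu.eventually (Metric.ball_mem_nhds x₀ hδ)] with n hn hun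
    exact hn _ hun

theorem IsLaplaceAmplitude.eventually_integrableOn_and_tendsto {m : ℕ}
    {U B₀ : Set (EuclideanSpace ℝ (Fin m))} {x₀ : EuclideanSpace ℝ (Fin m)}
    {f : EuclideanSpace ℝ (Fin m) → ℂ} (hU : IsOpen U) (hB₀ : IsCompact B₀)
    (hx₀ : B₀ ∈ 𝓝 x₀) (hB₀U : B₀ ⊆ U) (hf : IsLaplaceBase U B₀ x₀ f)
    {φ : ℕ → EuclideanSpace ℝ (Fin m) → ℝ} (hφ : IsLaplaceAmplitude U B₀ x₀ f φ) :
    (∀ᶠ n in atTop, IntegrableOn (fun x => (φ n x : ℂ) * f x ^ n) U) ∧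
    Tendsto (fun n : ℕ => ((√(n : ℝ) ^ m / (φ n x₀ * (f x₀).re ^ n) : ℝ) : ℂ)
        * ∫ x in U, (φ n x : ℂ) * f x ^ n) atTop
      (𝓝 (((2 * Real.pi * (f x₀).re) ^ ((m : ℝ) / 2)
        * |(hessianMatrix (fun x => (f x).re) x₀).det| ^ (-(1 / 2) : ℝ) : ℝ) : ℂ)) := by
  have hpos := hf.pos x₀ (mem_of_mem_nhds hx₀)
  obtain ⟨c, hc, hcf, hfc⟩ := hf.exists_norm_le hx₀ isOpen_interior
    (mem_interior_iff_mem_nhds.2 hx₀) interior_subset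
  obtain ⟨C, k, htail⟩ := hφ.eventually_tail hf.aestronglyMeasurable hU.measurableSet
    hB₀.measurableSet hc (fun x hx => hfc x ⟨hx.1, fun h => hx.2 (interior_subset h)⟩)
  have hintB : ∀ n, IntegrableOn (fun x => (φ n x : ℂ) * f x ^ n) B₀ := fun n =>
    ((Complex.continuous_ofReal.comp_continuousOn (hφ.contDiffOn n).continuousOn).mul
      (hf.contDiffOn.continuousOn.pow n)).integrableOn_compact hB₀
  have hUnion : B₀ ∪ U \ B₀ = U := Set.union_sdiff_cancel hB₀U
  refine ⟨?_, ?_⟩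
  · filter_upwards [htail] with n hn
    rw [← hUnion]
    exact (hintB n).union hn.1
  · have hlocal := (Complex.continuous_ofReal.tendsto _).comp
      (hf.tendsto_setIntegral hB₀ hx₀ hB₀U hφ)
    have hfar : Tendsto (fun n : ℕ => ((√(n : ℝ) ^ m / (φ n x₀ * (f x₀).re ^ n) : ℝ) : ℂ)
        * ∫ x in U \ B₀, (φ n x : ℂ) * f x ^ n) atTop (𝓝 0) := by
      have h0 := (tendsto_sqrt_pow_mul_rpow_mul_pow m k (div_pos hc hpos)
        ((div_lt_one hpos).2 hcf)).const_mul C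
      rw [mul_zero] at h0
      refine squeeze_zero_norm' ?_ h0
      filter_upwards [htail] with n hn
      have hφ0 := abs_pos.2 (hφ.ne_zero n)
      rw [norm_mul, Complex.norm_real, Real.norm_eq_abs, abs_div, abs_mul,
        abs_of_nonneg (pow_nonneg (Real.sqrt_nonneg _) m), abs_of_pos (pow_pos hpos n)]
      refine (mul_le_mul_of_nonneg_left hn.2 (by positivity)).trans_eq ?_
      rw [div_pow]
      field_simp
    have hsum := hlocal.add hfar
    rw [add_zero] at hsum
    refine hsum.congr' ?_
    filter_upwards [htail] with n hn
    have hBeq : ∫ x in B₀, (φ n x : ℂ) * f x ^ n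
        = ((φ n x₀ * (f x₀).re ^ n *
          ∫ x in B₀, φ n x / φ n x₀ * ((f x₀).re⁻¹ * (f x).re) ^ n : ℝ) : ℂ) := by
      rw [← integral_const_mul, ← integral_complex_ofReal]
      refine setIntegral_congr_fun hB₀.measurableSet fun x hx => ?_
      have hfx : f x = ((f x).re : ℂ) := Complex.ext rfl (by simpa using hf.real x hx)
      have hreal : φ n x₀ * (f x₀).re ^ n * (φ n x / φ n x₀ * ((f x₀).re⁻¹ * (f x).re) ^ n)
          = φ n x * (f x).re ^ n := by
        have := hφ.ne_zero n
        rw [mul_pow, inv_pow]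
        field_simp
      simp only [hreal]
      push_cast
      rw [← hfx]
    conv_rhs => rw [← hUnion, setIntegral_union Set.disjoint_sdiff_right
      (hU.measurableSet.diff hB₀.measurableSet) (hintB n) hn.1, mul_add, hBeq, ← Complex.ofReal_mul]
    simp only [Function.comp_apply]
    congr 2
    have := hφ.ne_zero n
    field_simp

theorem IsLaplaceAmplitude.isEquivalent {m : ℕ}
    {U B₀ : Set (EuclideanSpace ℝ (Fin m))} {x₀ : EuclideanSpace ℝ (Fin m)}
    {f : EuclideanSpace ℝ (Fin m) → ℂ} (hU : IsOpen U) (hB₀ : IsCompact B₀)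
    (hx₀ : B₀ ∈ 𝓝 x₀) (hB₀U : B₀ ⊆ U) (hf : IsLaplaceBase U B₀ x₀ f)
    {φ : ℕ → EuclideanSpace ℝ (Fin m) → ℝ} (hφ : IsLaplaceAmplitude U B₀ x₀ f φ) :
    (fun n : ℕ => ∫ x in U, (φ n x : ℂ) * f x ^ n) ~[atTop]
      (fun n : ℕ =>
        ((|(hessianMatrix (fun x => (f x).re) x₀).det| ^ (-(1 / 2) : ℝ)
          * (2 * Real.pi / (n : ℝ)) ^ ((m : ℝ) / 2)
          * φ n x₀ * (f x₀).re ^ ((n : ℝ) + (m : ℝ) / 2) : ℝ) : ℂ)) := by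
  have hpos := hf.pos x₀ (mem_of_mem_nhds hx₀)
  have hlim := (hφ.eventually_integrableOn_and_tendsto hU hB₀ hx₀ hB₀U hf).2
  set H := hessianMatrix (fun x => (f x).re) x₀ with hH
  have hdet : 0 < |H.det| := by
    refine abs_pos.2 fun h0 => ?_
    have h1 := hf.negDef.det_pos
    rw [← hH, Matrix.det_neg, h0, mul_zero] at h1
    exact h1.false
  set G : ℝ := (2 * Real.pi * (f x₀).re) ^ ((m : ℝ) / 2) * |H.det| ^ (-(1 / 2) : ℝ) with hG
  have hGpos : 0 < G := by positivity
  have hD : ∀ᶠ n : ℕ in atTop, √(n : ℝ) ^ m / (φ n x₀ * (f x₀).re ^ n) ≠ 0 := by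
    filter_upwards [eventually_gt_atTop 0] with n hn
    have hn' : (0 : ℝ) < n := by exact_mod_cast hn
    have := hφ.ne_zero n
    positivity
  have hT : ∀ᶠ n : ℕ in atTop, |H.det| ^ (-(1 / 2) : ℝ) * (2 * Real.pi / (n : ℝ)) ^ ((m : ℝ) / 2)
      * φ n x₀ * (f x₀).re ^ ((n : ℝ) + (m : ℝ) / 2)
      = G / (√(n : ℝ) ^ m / (φ n x₀ * (f x₀).re ^ n)) := by
    filter_upwards [eventually_gt_atTop 0] with n hn
    have hn' : (0 : ℝ) < n := by exact_mod_cast hn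
    have h1 : √(n : ℝ) ^ m = (n : ℝ) ^ ((m : ℝ) / 2) := by
      rw [Real.sqrt_eq_rpow, ← Real.rpow_natCast, ← Real.rpow_mul hn'.le]
      ring_nf
    rw [h1, Real.rpow_add hpos, Real.rpow_natCast, Real.div_rpow (by positivity) hn'.le, hG,
      Real.mul_rpow (by positivity) hpos.le]
    have : 0 < (n : ℝ) ^ ((m : ℝ) / 2) := by positivity
    field_simp
  have hGc : (G : ℂ) ≠ 0 := by exact_mod_cast hGpos.ne'
  have hequiv := (isEquivalent_const_iff_tendsto hGc).2 hlim
  have hequiv2 := hequiv.mul (IsEquivalent.refl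
    (u := fun n : ℕ => (((√(n : ℝ) ^ m / (φ n x₀ * (f x₀).re ^ n))⁻¹ : ℝ) : ℂ)) (l := atTop))
  refine (hequiv2.congr_left ?_).congr_right ?_
  · filter_upwards [hD] with n hn
    have hn' : ((√(n : ℝ) ^ m / (φ n x₀ * (f x₀).re ^ n) : ℝ) : ℂ) ≠ 0 := by exact_mod_cast hn
    simp only [Pi.mul_apply, Complex.ofReal_inv]
    rw [mul_right_comm, mul_inv_cancel₀ hn', one_mul]
  · filter_upwards [hT] with n hn
    rw [hn, div_eq_mul_inv]
    exact (Complex.ofReal_mul _ _).symm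

theorem mainTheorem4 {m : ℕ} (U B₀ : Set (EuclideanSpace ℝ (Fin m)))
    (x₀ : EuclideanSpace ℝ (Fin m)) (hU : IsOpen U) (hB₀ : IsCompact B₀)
    (hx₀ : B₀ ∈ 𝓝 x₀) (hB₀U : B₀ ⊆ U)
    (f : EuclideanSpace ℝ (Fin m) → ℂ) (hf : IsLaplaceBase U B₀ x₀ f) :
    (∀ φ : ℕ → EuclideanSpace ℝ (Fin m) → ℝ, IsLaplaceAmplitude U B₀ x₀ f φ →
      (∀ᶠ n in atTop, IntegrableOn (fun x => (φ n x : ℂ) * f x ^ n) U) ∧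
      (fun n : ℕ => ∫ x in U, (φ n x : ℂ) * f x ^ n) ~[atTop]
        (fun n : ℕ =>
          ((|(hessianMatrix (fun x => (f x).re) x₀).det| ^ (-(1 / 2) : ℝ)
            * (2 * Real.pi / (n : ℝ)) ^ ((m : ℝ) / 2)
            * φ n x₀ * (f x₀).re ^ ((n : ℝ) + (m : ℝ) / 2) : ℝ) : ℂ))) ∧
    (∀ φ ψ : ℕ → EuclideanSpace ℝ (Fin m) → ℝ,
      IsLaplaceAmplitude U B₀ x₀ f φ → IsLaplaceAmplitude U B₀ x₀ f ψ →
      (fun n : ℕ => (∫ x in U, (ψ n x : ℂ) * f x ^ n) / ∫ x in U, (φ n x : ℂ) * f x ^ n)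
        ~[atTop] (fun n : ℕ => ((ψ n x₀ / φ n x₀ : ℝ) : ℂ))) := by
  refine ⟨fun φ hφ => ⟨(hφ.eventually_integrableOn_and_tendsto hU hB₀ hx₀ hB₀U hf).1,
    hφ.isEquivalent hU hB₀ hx₀ hB₀U hf⟩, fun φ ψ hφ hψ => ?_⟩
  have h := (hψ.isEquivalent hU hB₀ hx₀ hB₀U hf).div (hφ.isEquivalent hU hB₀ hx₀ hB₀U hf)
  refine h.congr_right ?_
  have hpos := hf.pos x₀ (mem_of_mem_nhds hx₀)
  have hdet : 0 < |(hessianMatrix (fun x => (f x).re) x₀).det| := by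
    refine abs_pos.2 fun h0 => ?_
    have h1 := hf.negDef.det_pos
    rw [Matrix.det_neg, h0, mul_zero] at h1
    exact h1.false
  filter_upwards [eventually_gt_atTop 0] with n hn
  have hn' : (0 : ℝ) < n := by exact_mod_cast hn
  have hφn := hφ.ne_zero n
  rw [Pi.div_apply, ← Complex.ofReal_div]
  congr 1
  have h1 : 0 < |(hessianMatrix (fun x => (f x).re) x₀).det| ^ (-(1 / 2) : ℝ) := by positivity
  have h2 : 0 < (2 * Real.pi / (n : ℝ)) ^ ((m : ℝ) / 2) := by positivity
  have h3 : 0 < (f x₀).re ^ ((n : ℝ) + (m : ℝ) / 2) := by positivity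
  field_simp
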